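/- All graphs are finite. For a graph $G=(V,E)$ write $\mathcal I_G$ for its collection of independent sets and, for $\vec\lambda=(\lambda_v)_{v\in V}\in\mathbb C^V$, let $$Z_G(\vec\lambda)=\sum_{I\in\mathcal I_G}\ \prod_{v\in I}\lambda_v .$$ Conditional ratios. A boundary condition on $G$ is a map $\sigma:V_\sigma\to\{0,1\}$ with $V_\sigma\subseteq V$ such that $\sigma^{-1}(1)$ is independent. For $v\in V\setminus V_\sigma$ and $\lambda>0$ put $$R_{(G,\sigma),v}(\lambda)=\frac{\sum\{\lambda^{|I|}:\ I\subseteq V\setminus V_\sigma,\ I\cup\sigma^{-1}(1)\in\mathcal I_G,\ v\in I\}}{\sum\{\lambda^{|I|}:\ I\subseteq V\setminus V_\sigma,\ I\cup\sigma^{-1}(1)\in\mathcal I_G,\ v\notin I\}} .$$ Tree of self-avoiding walks. Let $H$ be a graph with a total ordering of its vertices, and let $v\in V(H)$ have neighbours $v_1<\dots<v_d$ in $H$. The rooted tree $T_{\mathrm{SAW}(H,v)}$ is defined recursively: for $i=1,\dots,d$ let $H_i$ be the graph $H$ with $v,v_1,\dots,v_{i-1}$ removed (with the inherited ordering); then $T_{\mathrm{SAW}(H,v)}$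 is obtained from the disjoint union of the trees $T_{\mathrm{SAW}(H_i,v_i)}$, $i=1,\dots,d$, by adding a root $v$ and joining it by an edge to the root of each of them. (For $d=0$ it is a single vertex.) Very strong spatial mixing (VSSM). Let $\mathcal G$ be a family of graphs of bounded degree, and fix a total ordering of the vertices of each $G\in\mathcal G$; induced subgraphs inherit the ordering. The hard-core model on $\mathcal G$ satisfies VSSM at $\lambda>0$ if there are constants $\alpha\in[0,1)$ and $C>0$ such that for every $G\in\mathcal G$, every induced subgraph $H$ of $G$, every $v\in V(H)$, every integer $\ell\ge 1$, and all boundary conditions $\sigma,\tau:S_\ell\to\{0,1\}$ on the set $S_\ell$ of the vertices at distance $\ell$ from the root $v$ of $T=T_{\mathrm{SAW}(H,v)}$, $$\bigl|R_{(T,\sigma),v}(\lambda)-R_{(T,\tau),v}(\lambda)\bigr|\le C\,\alpha^{\ell}.$$ Theorem. Let $\Delta\in\mathbb N$ and $\lambda^\star>0$, and let $\mathcal G$ be a family of graphs of maximum degree at most $\Delta$. If the hard-core model on $\mathcal G$ satisfies very strong spatial mixing at $\lambda^\star$, then there exists $\varepsilon>0$ such that $Z_G(\vec\lambda)\neq 0$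 for every $G=(V,E)\in\mathcal G$ and every $\vec\lambda\in B(\lambda^\star,\varepsilon)^V$, where $B(\lambda^\star,\varepsilon)$ is the open disk in $\mathbb C$ of radius $\varepsilon$ centred at $\lambda^\star$. -/

import Mathlib

universe u

namespace HardCore

noncomputable section

open Classical in
/-- The multivariate independence polynomial `∑_I ∏_{v ∈ I} x v`, summed over the independent
sets `I` of a finite graph `G`. -/
def indepPoly {V : Type u} [Fintype V] (G : SimpleGraph V) (x : V → ℂ) : ℂ :=
  ∑ I ∈ (Finset.univ : Finset (Finset V)).filter (fun I : Finset V => G.IsIndepSet (I : Set V)),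
    ∏ v ∈ I, x v

/-- A boundary condition on a graph `G`, i.e. a map `σ : V_σ → {0, 1}` on a set `V_σ` of vertices
such that `σ⁻¹(1)` is independent. The map is recorded by its domain `dom = V_σ` and by the set
`occ = σ⁻¹(1)` of the vertices that are set to be `in`. -/
structure BoundaryCondition {V : Type u} (G : SimpleGraph V) where
  dom : Finset V
  occ : Finset V
  occ_subset : occ ⊆ dom
  indep : G.IsIndepSet (occ : Set V)

open Classical in
/-- `Z^{v in}_{(G,σ)}(t)`: the sum of `t ^ |I|` over the sets `I ⊆ V \ V_σ` that contain `v` and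
for which `I ∪ σ⁻¹(1)` is independent. -/
def condZIn {V : Type u} [Fintype V] (G : SimpleGraph V) (σ : BoundaryCondition G) (v : V)
    (t : ℝ) : ℝ :=
  ∑ I ∈ (Finset.univ : Finset (Finset V)).filter (fun I : Finset V =>
      v ∈ I ∧ Disjoint I σ.dom ∧ G.IsIndepSet ((I ∪ σ.occ : Finset V) : Set V)),
    t ^ I.card

open Classical in
/-- `Z^{v out}_{(G,σ)}(t)`: the sum of `t ^ |I|` over the sets `I ⊆ V \ V_σ` that do not contain
`v` and for which `I ∪ σ⁻¹(1)` is independent. -/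
def condZOut {V : Type u} [Fintype V] (G : SimpleGraph V) (σ : BoundaryCondition G) (v : V)
    (t : ℝ) : ℝ :=
  ∑ I ∈ (Finset.univ : Finset (Finset V)).filter (fun I : Finset V =>
      v ∉ I ∧ Disjoint I σ.dom ∧ G.IsIndepSet ((I ∪ σ.occ : Finset V) : Set V)),
    t ^ I.card

/-- The conditional occupation ratio `R_{(G,σ),v}(t)`. For `t > 0` the denominator is positive. -/
def condRatio {V : Type u} [Fintype V] (G : SimpleGraph V) (σ : BoundaryCondition G) (v : V)
    (t : ℝ) : ℝ :=
  condZIn G σ v t / condZOut G σ v t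

/-- A finite graph with a distinguished vertex. -/
structure RootedGraph where
  Vert : Type u
  fintype : Fintype Vert
  graph : SimpleGraph Vert
  root : Vert

attribute [instance] RootedGraph.fintype

/-- Adjacency in the graph obtained from the disjoint union of the rooted graphs `T i` by adding
one new vertex `none` and connecting it to the root of each `T i`. -/
inductive JoinAdj {ι : Type u} (T : ι → RootedGraph.{u}) :
    Option (Σ i, (T i).Vert) → Option (Σ i, (T i).Vert) → Prop
  | toRoot (i : ι) : JoinAdj T none (some ⟨i, (T i).root⟩)
  | fromRoot (i : ι) : JoinAdj T (some ⟨i, (T i).root⟩) none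
  | inner (i : ι) (x y : (T i).Vert) (h : (T i).graph.Adj x y) :
      JoinAdj T (some ⟨i, x⟩) (some ⟨i, y⟩)

/-- The rooted graph obtained from the disjoint union of the rooted graphs `T i` by adding
one new vertex, the new root, and connecting it to the root of each `T i`. -/
def RootedGraph.join {ι : Type u} [Fintype ι] (T : ι → RootedGraph.{u}) : RootedGraph.{u} where
  Vert := Option (Σ i, (T i).Vert)
  fintype := inferInstance
  graph :=
    { Adj := JoinAdj T
      symm := ⟨fun _ _ h => by
        cases h with
        | toRoot i => exact .fromRoot i
        | fromRoot i => exact .toRoot i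
        | inner i x y h => exact .inner i y x h.symm⟩
      loopless := ⟨fun _ h => by
        cases h with
        | inner i x _ h => exact h.ne rfl⟩ }
  root := none

open Classical in
/-- For a neighbour `w` of `v`: the vertices of `S` that are left after removing `v` and the
neighbours of `v` that come before `w`. -/
def sawRemaining {V : Type u} [LinearOrder V] (G : SimpleGraph V) (S : Finset V) (v w : V) :
    Finset V :=
  {x ∈ S | x ≠ v ∧ ¬ (G.Adj v x ∧ x < w)}

theorem mem_sawRemaining {V : Type u} [LinearOrder V] (G : SimpleGraph V) (S : Finset V)
    (v w : V) (hw : w ∈ S) (h : G.Adj v w) : w ∈ sawRemaining G S v w := by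
  simp [sawRemaining, hw, h.ne']

theorem card_sawRemaining_lt {V : Type u} [LinearOrder V] (G : SimpleGraph V) (S : Finset V)
    (v w : V) (hv : v ∈ S) : (sawRemaining G S v w).card < S.card := by
  classical
  refine Finset.card_lt_card ⟨Finset.filter_subset _ _, fun h => ?_⟩
  have := h hv
  simp [sawRemaining] at this

open Classical in
/-- The tree of self avoiding walks of `(H, v)`, where `H` is the subgraph of `G` induced by `S`
and `v` is a vertex of `H`. If `v₁ < ⋯ < v_d` are the neighbours of `v` in `H`, then it is obtained
from the disjoint union of the trees of self avoiding walks of `(H \ {v, v₁, …, v_{i-1}}, v_i)`,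
for `i = 1, …, d`, by adding a root and connecting it to the root of each of them.
(For `d = 0` it is a single vertex.) -/
def sawTree {V : Type u} [LinearOrder V] (G : SimpleGraph V) (S : Finset V) (v : S) :
    RootedGraph.{u} :=
  RootedGraph.join fun w : {w : S // G.Adj v w} =>
    sawTree G (sawRemaining G S v w.1)
      ⟨w.1, mem_sawRemaining G S v w.1 w.1.2 w.2⟩
termination_by S.card
decreasing_by exact card_sawRemaining_lt G S v w.1 v.2

open Classical in
/-- The vertices of `T` at distance `l` from the root (for `l ≥ 1`). -/
def RootedGraph.sphere (T : RootedGraph.{u}) (l : ℕ) : Finset T.Vert :=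
  {x : T.Vert | T.graph.Reachable T.root x ∧ T.graph.dist T.root x = l}

/-- Very strong spatial mixing at `t` for the hard-core model on a family of finite graphs `G i`,
with a fixed total ordering on the vertices of each of them: there are `α ∈ [0, 1)` and `C > 0`
such that, for every induced subgraph `H` of a member of the family and every vertex `v` of `H`,
the ratios at the root of the tree of self avoiding walks of `(H, v)` for any two boundary
conditions on the vertices at distance `l ≥ 1` from the root differ by at most `C * α ^ l`.
Induced subgraphs inherit the ordering, and are given by their vertex sets `S`. -/
def VSSM {ι : Type*} (V : ι → Type u) [∀ i, LinearOrder (V i)]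
    (G : ∀ i, SimpleGraph (V i)) (t : ℝ) : Prop :=
  ∃ α C : ℝ, 0 ≤ α ∧ α < 1 ∧ 0 < C ∧
    ∀ (i : ι) (S : Finset (V i)) (v : S) (l : ℕ), 1 ≤ l →
      ∀ σ τ : BoundaryCondition (sawTree (G i) S v).graph,
        σ.dom = (sawTree (G i) S v).sphere l → τ.dom = (sawTree (G i) S v).sphere l →
          |condRatio (sawTree (G i) S v).graph σ (sawTree (G i) S v).root t -
            condRatio (sawTree (G i) S v).graph τ (sawTree (G i) S v).root t| ≤ C * α ^ l

end

end HardCore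

namespace HardCore

noncomputable section

open Finset

/-! On a tree of self-avoiding walks the ratios satisfy r(x) = t ∏ 1/(1 + r(w)) over the children w
of x. In logarithmic coordinates, log r(x) has derivative -p(w) in log r(w), where p = r/(1 + r). So
`influence` at depth l is the ℓ¹-norm of the derivative of log r at the root in the logarithms at
depth l.

Mixing bounds these influences (`exists_sum_influence_le`). Emptying a whole level moves log r at
the root by an exponentially small amount. Since the recursion is antitone, all vertices of a level
push in the same direction and nothing cancels. Convexity of s ↦ log(1 + e^s) then bounds this
finite change below by the derivative, up to a factor whose product over all levels stays bounded
(`influence_le_log_sub_log`). So the influences decay geometrically and their sums Φ are uniformly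
bounded.

Level by level, Φ(x) = 1 + ∑ p(w) Φ(w). Hence the bound |log(R/r)| ≤ δ Φ on the complex ratios R
survives a step of the recursion: the linear part uses up δ ∑ p(w) Φ(w), and the spare δ absorbs the
perturbation of the vertex weight and the quadratic errors. Every 1 + R is then nonzero, and the
polynomial is built up one vertex at a time from such factors
(`indepPolyOn_ne_zero_and_complexRatio`). -/

/-- Concavity of the logarithm, in the form of a lower bound for `log (1 + b) - log (1 + a)`. -/
theorem mul_log_sub_log_le {a b : ℝ} (ha : 0 < a) (hb : 0 < b) :
    a / (1 + a) * (Real.log b - Real.log a) ≤ Real.log (1 + b) - Real.log (1 + a) := by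
  have h : 1 / (1 + a) * Real.log 1 + a / (1 + a) * Real.log (b / a) ≤
      Real.log (1 / (1 + a) * 1 + a / (1 + a) * (b / a)) :=
    strictConcaveOn_log_Ioi.concaveOn.2 (Set.mem_Ioi.2 one_pos) (Set.mem_Ioi.2 (div_pos hb ha))
      (by positivity) (by positivity) (by field_simp)
  simp only [Real.log_one, mul_zero, zero_add] at h
  rw [Real.log_div hb.ne' ha.ne'] at h
  refine h.trans_eq ?_
  rw [← Real.log_div (by positivity) (by positivity)]
  congr 1
  field_simp

/-! ### The real tree recursion, its truncations and the total influence -/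

section Recursion

variable {X : Type*} {κ : X → Type*} [∀ x, Fintype (κ x)] (c : ∀ x, κ x → X) (t : ℝ)

/-- The probability that the root is unoccupied, computed by the tree recursion to depth `l`,
starting from the value `a`. -/
def truncOut (a : ℝ) : ℕ → X → ℝ
  | 0, _ => a
  | l + 1, x => (1 + t * ∏ w, truncOut a l (c x w))⁻¹

/-- The ratio at the root, computed by the tree recursion to depth `l + 1`. -/
def truncRatio (a : ℝ) (l : ℕ) (x : X) : ℝ := t * ∏ w, truncOut c t a l (c x w)

theorem truncOut_succ (a : ℝ) (l : ℕ) (x : X) :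
    truncOut c t a (l + 1) x = (1 + truncRatio c t a l x)⁻¹ := rfl

theorem truncRatio_succ (a : ℝ) (l : ℕ) (x : X) :
    truncRatio c t a (l + 1) x = t * ∏ w, (1 + truncRatio c t a l (c x w))⁻¹ := rfl

/-- The total influence on the root of the vertices at depth `l`. -/
def influence (r : X → ℝ) : ℕ → X → ℝ
  | 0, _ => 1
  | l + 1, x => ∑ w, r (c x w) / (1 + r (c x w)) * influence r l (c x w)

variable {c t}

theorem truncOut_mem_Icc (ht : 0 < t) {a : ℝ} (ha : a ∈ Set.Icc (0 : ℝ) 1) (l : ℕ) (x : X) :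
    truncOut c t a l x ∈ Set.Icc (0 : ℝ) 1 := by
  induction l generalizing x with
  | zero => exact ha
  | succ l ih =>
    have h : 0 ≤ t * ∏ w, truncOut c t a l (c x w) :=
      mul_nonneg ht.le (prod_nonneg fun w _ => (ih _).1)
    exact ⟨inv_nonneg.2 (by linarith), inv_le_one_of_one_le₀ (by linarith)⟩

theorem truncRatio_nonneg (ht : 0 < t) {a : ℝ} (ha : a ∈ Set.Icc (0 : ℝ) 1) (l : ℕ) (x : X) :
    0 ≤ truncRatio c t a l x :=
  mul_nonneg ht.le (prod_nonneg fun _ _ => (truncOut_mem_Icc ht ha _ _).1)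

theorem truncRatio_le (ht : 0 < t) {a : ℝ} (ha : a ∈ Set.Icc (0 : ℝ) 1) (l : ℕ) (x : X) :
    truncRatio c t a l x ≤ t :=
  mul_le_of_le_one_right ht.le
    (prod_le_one (fun _ _ => (truncOut_mem_Icc ht ha _ _).1)
      fun _ _ => (truncOut_mem_Icc ht ha _ _).2)

/-- The boundary value 0 admits no such bound at depth 0; this is why logarithms are taken only of
truncations with boundary value 1. -/
theorem truncOut_one_ge (ht : 0 < t) (l : ℕ) (x : X) : (1 + t)⁻¹ ≤ truncOut c t 1 l x := by
  cases l with
  | zero => exact inv_le_one_of_one_le₀ (by linarith)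
  | succ l =>
    rw [truncOut_succ]
    have h₀ := truncRatio_nonneg (c := c) ht (a := 1) (by simp) l x
    have h₁ := truncRatio_le (c := c) ht (a := 1) (by simp) l x
    gcongr

theorem mul_pow_le_mul_prod (ht : 0 < t) {Δ : ℕ} {x : X} (hΔ : Fintype.card (κ x) ≤ Δ)
    {f : κ x → ℝ} (hf : ∀ w, (1 + t)⁻¹ ≤ f w) : t * (1 + t)⁻¹ ^ Δ ≤ t * ∏ w, f w := by
  gcongr
  calc (1 + t)⁻¹ ^ Δ ≤ (1 + t)⁻¹ ^ Fintype.card (κ x) :=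
        pow_le_pow_of_le_one (by positivity) (inv_le_one_of_one_le₀ (by linarith)) hΔ
    _ = ∏ _w : κ x, (1 + t)⁻¹ := by simp
    _ ≤ ∏ w, f w := prod_le_prod (fun _ _ => by positivity) fun w _ => hf w

variable {r : X → ℝ}

theorem ratio_le (ht : 0 < t) (hpos : ∀ x, 0 < r x)
    (hr : ∀ x, r x = t * ∏ w, (1 + r (c x w))⁻¹) (x : X) : r x ≤ t := by
  rw [hr]
  exact mul_le_of_le_one_right ht.le
    (prod_le_one (fun w _ => inv_nonneg.2 (by linarith [hpos (c x w)]))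
      fun w _ => inv_le_one_of_one_le₀ (by linarith [hpos (c x w)]))

/-- The ratio lies between the truncated ratios with extremal boundary values, in an order that
depends on the parity of the depth. -/
theorem truncOut_sandwich (ht : 0 < t) (hpos : ∀ x, 0 < r x)
    (hr : ∀ x, r x = t * ∏ w, (1 + r (c x w))⁻¹) (l : ℕ) :
    (Even l → ∀ x, truncOut c t 0 l x ≤ (1 + r x)⁻¹ ∧ (1 + r x)⁻¹ ≤ truncOut c t 1 l x) ∧
    (Odd l → ∀ x, truncOut c t 1 l x ≤ (1 + r x)⁻¹ ∧ (1 + r x)⁻¹ ≤ truncOut c t 0 l x) := by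
  -- A step of the recursion reverses order, so the two boundary values swap roles at each level.
  have key : ∀ (f g : X → ℝ) (x : X), (∀ y, 0 ≤ f y) → (∀ y, f y ≤ g y) →
      (1 + t * ∏ w, g (c x w))⁻¹ ≤ (1 + t * ∏ w, f (c x w))⁻¹ := by
    intro f g x hf hfg
    have h : 0 ≤ t * ∏ w, f (c x w) := mul_nonneg ht.le (prod_nonneg fun w _ => hf _)
    have h' : ∏ w, f (c x w) ≤ ∏ w, g (c x w) :=
      prod_le_prod (fun w _ => hf _) fun w _ => hfg _
    gcongr
  have hr' : ∀ x, (1 + r x)⁻¹ = (1 + t * ∏ w, (1 + r (c x w))⁻¹)⁻¹ := fun x => by rw [← hr]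
  have hn : ∀ x, 0 ≤ (1 + r x)⁻¹ := fun x => inv_nonneg.2 (by linarith [hpos x])
  have h0 : ∀ l x, 0 ≤ truncOut c t 0 l x := fun l x => (truncOut_mem_Icc ht (by simp) l x).1
  have h1 : ∀ l x, 0 ≤ truncOut c t 1 l x := fun l x => (truncOut_mem_Icc ht (by simp) l x).1
  induction l with
  | zero =>
    refine ⟨fun _ x => ⟨hn x, inv_le_one_of_one_le₀ (by linarith [hpos x])⟩, fun h => ?_⟩
    simp at h
  | succ l ih =>
    refine ⟨fun h x => ?_, fun h x => ?_⟩
    · have hl : Odd l := by simpa [Nat.even_add_one] using h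
      rw [hr']
      exact ⟨key _ _ x hn fun y => (ih.2 hl y).2, key _ _ x (h1 l) fun y => (ih.2 hl y).1⟩
    · have hl : Even l := by simpa [Nat.odd_add_one] using h
      rw [hr']
      exact ⟨key _ _ x hn fun y => (ih.1 hl y).2, key _ _ x (h0 l) fun y => (ih.1 hl y).1⟩

theorem abs_truncRatio_sub_le (ht : 0 < t) (hpos : ∀ x, 0 < r x)
    (hr : ∀ x, r x = t * ∏ w, (1 + r (c x w))⁻¹) (l : ℕ) (x : X) :
    |truncRatio c t 1 l x - r x| ≤ |truncRatio c t 1 l x - truncRatio c t 0 l x| := by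
  have hp : ∀ y, 0 < 1 + r y := fun y => by linarith [hpos y]
  have h0 : ∀ l x, 0 < 1 + truncRatio c t 0 l x := fun l x => by
    linarith [truncRatio_nonneg (c := c) ht (a := 0) (by simp) l x]
  have h1 : ∀ l x, 0 < 1 + truncRatio c t 1 l x := fun l x => by
    linarith [truncRatio_nonneg (c := c) ht (a := 1) (by simp) l x]
  have h := truncOut_sandwich ht hpos hr (l + 1)
  simp only [truncOut_succ, inv_le_inv₀ (h0 _ _) (hp _), inv_le_inv₀ (h1 _ _) (hp _),
    inv_le_inv₀ (hp _) (h0 _ _), inv_le_inv₀ (hp _) (h1 _ _)] at h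
  rcases Nat.even_or_odd (l + 1) with hl | hl
  · obtain ⟨ha, hb⟩ := h.1 hl x
    rw [abs_of_nonpos (by linarith), abs_of_nonpos (by linarith)]
    linarith
  · obtain ⟨ha, hb⟩ := h.2 hl x
    rw [abs_of_nonneg (by linarith), abs_of_nonneg (by linarith)]
    linarith

theorem ratio_le_or_ge_truncRatio_of_parity (ht : 0 < t) (hpos : ∀ x, 0 < r x)
    (hr : ∀ x, r x = t * ∏ w, (1 + r (c x w))⁻¹) (l : ℕ) (x : X) :
    (Even l → r x ≤ truncRatio c t 1 l x) ∧ (Odd l → truncRatio c t 1 l x ≤ r x) := by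
  have hp : ∀ y, 0 < 1 + r y := fun y => by linarith [hpos y]
  have h1 : ∀ l x, 0 < 1 + truncRatio c t 1 l x := fun l x => by
    linarith [truncRatio_nonneg (c := c) ht (a := 1) (by simp) l x]
  have h := truncOut_sandwich ht hpos hr (l + 1)
  simp only [truncOut_succ, inv_le_inv₀ (h1 _ _) (hp _), inv_le_inv₀ (hp _) (h1 _ _)] at h
  refine ⟨fun hl => ?_, fun hl => ?_⟩
  · linarith [(h.2 hl.add_one x).1]
  · linarith [(h.1 hl.add_one x).2]

theorem influence_nonneg (hpos : ∀ x, 0 < r x) (l : ℕ) (x : X) : 0 ≤ influence c r l x := by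
  induction l generalizing x with
  | zero => exact zero_le_one
  | succ l ih =>
    exact sum_nonneg fun w _ => mul_nonneg
      (div_nonneg (hpos _).le (by linarith [hpos (c x w)])) (ih _)

theorem log_mul_prod_inv (ht : 0 < t) {x : X} {f : κ x → ℝ} (hf : ∀ w, 0 < 1 + f w) :
    Real.log (t * ∏ w, (1 + f w)⁻¹) = Real.log t - ∑ w, Real.log (1 + f w) := by
  rw [Real.log_mul ht.ne' (prod_ne_zero_iff.2 fun w _ => (inv_pos.2 (hf w)).ne'),
    Real.log_prod (fun w _ => (inv_pos.2 (hf w)).ne')]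
  simp [Real.log_inv, sub_eq_add_neg]

/-- The influence of the vertices at depth `l + 1` is controlled by the effect on the root of
setting all of them to be unoccupied. -/
theorem influence_le_log_sub_log (ht : 0 < t) (hpos : ∀ x, 0 < r x)
    (hr : ∀ x, r x = t * ∏ w, (1 + r (c x w))⁻¹) {e : ℕ → ℝ} (he₀ : ∀ l, 0 ≤ e l)
    (hlow : ∀ l x, 0 < truncRatio c t 1 l x)
    (hclose : ∀ l x, Real.log (r x) - Real.log (truncRatio c t 1 l x) ≤ e l) (l : ℕ) (x : X) :
    Real.exp (-∑ j ∈ range l, e j) * influence c r (l + 1) x ≤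
      (-1) ^ l * (Real.log (truncRatio c t 1 l x) - Real.log (r x)) := by
  have hp : ∀ y, 0 < 1 + r y := fun y => by linarith [hpos y]
  have hq : ∀ l y, 0 < 1 + truncRatio c t 1 l y := fun l y => by linarith [hlow l y]
  induction l generalizing x with
  | zero =>
    -- With all children empty the ratio is t, so the difference of logarithms is ∑ log (1 + r), and
    -- each term is at least r / (1 + r).
    have h : truncRatio c t 1 0 x = t := by simp [truncRatio, truncOut]
    rw [h, hr x, log_mul_prod_inv ht fun w => hp _]
    simp only [range_zero, sum_empty, neg_zero, Real.exp_zero, pow_zero, one_mul, influence,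
      mul_one, sub_sub_cancel]
    refine sum_le_sum fun w _ => ?_
    have := Real.one_sub_inv_le_log_of_pos (hp (c x w))
    have h' := (hp (c x w)).ne'
    refine le_trans (le_of_eq ?_) this
    field_simp
    ring
  | succ l ih =>
    rw [truncRatio_succ, hr x, log_mul_prod_inv ht fun w => hp _,
      log_mul_prod_inv ht fun w => hq l _]
    have hrw : (-1 : ℝ) ^ (l + 1) *
        (Real.log t - ∑ w, Real.log (1 + truncRatio c t 1 l (c x w)) -
          (Real.log t - ∑ w, Real.log (1 + r (c x w)))) =
        ∑ w, (-1 : ℝ) ^ l *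
          (Real.log (1 + truncRatio c t 1 l (c x w)) - Real.log (1 + r (c x w))) := by
      rw [← mul_sum, sum_sub_distrib]
      ring
    rw [hrw, influence, mul_sum]
    refine sum_le_sum fun w _ => ?_
    set y := c x w
    have hi := ih y
    have hs := ratio_le_or_ge_truncRatio_of_parity ht hpos hr l y
    have hI := influence_nonneg (c := c) hpos (l + 1) y
    have hpr : 0 < r y / (1 + r y) := div_pos (hpos y) (hp y)
    set I := influence c r (l + 1) y
    set E := Real.exp (-∑ j ∈ range l, e j)
    have hE : Real.exp (-∑ j ∈ range (l + 1), e j) = E * Real.exp (-e l) := by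
      rw [sum_range_succ, neg_add, Real.exp_add]
    rw [hE]
    rcases Nat.even_or_odd l with hl | hl
    -- Here r ≤ ρ, with ρ the truncated ratio. The tangent at log r already has slope r / (1 + r),
    -- so nothing is lost and the factor exp (-e l) is discarded.
    · have he : Real.exp (-e l) ≤ 1 := by
        rw [Real.exp_le_one_iff, neg_nonpos]
        exact he₀ l
      have := mul_log_sub_log_le (hpos y) (hlow l y)
      rw [hl.neg_one_pow, one_mul] at hi ⊢
      calc E * Real.exp (-e l) * (r y / (1 + r y) * I)
          = Real.exp (-e l) * (r y / (1 + r y) * (E * I)) := by ring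
        _ ≤ 1 * (r y / (1 + r y) * (E * I)) := by gcongr
        _ ≤ r y / (1 + r y) * (Real.log (truncRatio c t 1 l y) - Real.log (r y)) := by
            rw [one_mul]; gcongr
        _ ≤ _ := this
    -- Here ρ ≤ r, and convexity only gives the slope ρ / (1 + ρ). Replacing it by r / (1 + r) costs
    -- at most ρ / r ≥ exp (-e l).
    · have h1 := mul_log_sub_log_le (hlow l y) (hpos y)
      have h2 := hclose l y
      have h3 := hs.2 hl
      rw [hl.neg_one_pow, neg_one_mul, neg_sub] at hi ⊢
      have h4 : Real.exp (-e l) ≤ truncRatio c t 1 l y / r y := by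
        rw [← Real.exp_log (div_pos (hlow l y) (hpos y)),
          Real.log_div (hlow l y).ne' (hpos y).ne', Real.exp_le_exp]
        linarith
      have h5 : Real.exp (-e l) * (r y / (1 + r y)) ≤
          truncRatio c t 1 l y / (1 + truncRatio c t 1 l y) := by
        calc Real.exp (-e l) * (r y / (1 + r y))
            ≤ truncRatio c t 1 l y / r y * (r y / (1 + r y)) := by gcongr
          _ = truncRatio c t 1 l y / (1 + r y) := by
              have := (hpos y).ne'
              field_simp
          _ ≤ _ := by
              have := hlow l y
              gcongr
      calc E * Real.exp (-e l) * (r y / (1 + r y) * I)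
          = Real.exp (-e l) * (r y / (1 + r y)) * (E * I) := by ring
        _ ≤ truncRatio c t 1 l y / (1 + truncRatio c t 1 l y) * (E * I) := by
            gcongr
        _ ≤ truncRatio c t 1 l y / (1 + truncRatio c t 1 l y) *
              (Real.log (r y) - Real.log (truncRatio c t 1 l y)) := by
            have := hlow l y
            gcongr
        _ ≤ _ := by linarith

/-- If the truncated ratios depend on the boundary in an exponentially decaying way, then the total
influence on the root is bounded. -/
theorem exists_sum_influence_le (ht : 0 < t) {Δ : ℕ} (hΔ : ∀ x, Fintype.card (κ x) ≤ Δ)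
    (hpos : ∀ x, 0 < r x) (hr : ∀ x, r x = t * ∏ w, (1 + r (c x w))⁻¹) {α C : ℝ}
    (hα₀ : 0 ≤ α) (hα₁ : α < 1) (hC : 0 < C)
    (h : ∀ l x, |truncRatio c t 1 l x - truncRatio c t 0 l x| ≤ C * α ^ (l + 1)) :
    ∃ K : ℝ, ∀ n x, ∑ l ∈ range n, influence c r l x ≤ K := by
  -- A common lower bound for all ratios, which makes the logarithm Lipschitz with constant 1 / m.
  set m := t * (1 + t)⁻¹ ^ Δ with hm
  have hm0 : 0 < m := by positivity
  have hrm : ∀ x, m ≤ r x := fun x => by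
    rw [hr x]
    refine mul_pow_le_mul_prod ht (hΔ x) fun w => ?_
    have := hpos (c x w)
    have := ratio_le ht hpos hr (c x w)
    gcongr
  have hρm : ∀ l x, m ≤ truncRatio c t 1 l x := fun l x =>
    mul_pow_le_mul_prod ht (hΔ x) fun w => truncOut_one_ge ht l _
  have hlog : ∀ {a b : ℝ}, m ≤ a → m ≤ b → Real.log a - Real.log b ≤ |a - b| / m := by
    intro a b ha hb
    have hb0 := hm0.trans_le hb
    have ha0 := hm0.trans_le ha
    rw [← Real.log_div ha0.ne' hb0.ne']
    calc Real.log (a / b) ≤ a / b - 1 := Real.log_le_sub_one_of_pos (by positivity)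
      _ = (a - b) / b := by field_simp
      _ ≤ |a - b| / b := by gcongr; exact le_abs_self _
      _ ≤ |a - b| / m := by gcongr
  have hdist : ∀ l x, |truncRatio c t 1 l x - r x| ≤ C * α ^ (l + 1) := fun l x =>
    (abs_truncRatio_sub_le ht hpos hr l x).trans (h l x)
  have hd1 : ∀ l x, Real.log (r x) - Real.log (truncRatio c t 1 l x) ≤ C * α ^ (l + 1) / m :=
    fun l x => (hlog (hrm x) (hρm l x)).trans (by
      rw [abs_sub_comm]; gcongr; exact hdist l x)
  have hd2 : ∀ l x, Real.log (truncRatio c t 1 l x) - Real.log (r x) ≤ C * α ^ (l + 1) / m :=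
    fun l x => (hlog (hρm l x) (hrm x)).trans (by gcongr; exact hdist l x)
  have hgeom : ∀ n, ∑ j ∈ range n, α ^ j ≤ (1 - α)⁻¹ := fun n => by
    rw [← tsum_geometric_of_lt_one hα₀ hα₁]
    exact (summable_geometric_of_lt_one hα₀ hα₁).sum_le_tsum _ fun j _ => by positivity
  set M := C / m * (1 - α)⁻¹
  have hM : ∀ n, ∑ j ∈ range n, C * α ^ (j + 1) / m ≤ M := fun n => by
    calc ∑ j ∈ range n, C * α ^ (j + 1) / m ≤ ∑ j ∈ range n, C / m * α ^ j := by
          refine sum_le_sum fun j _ => ?_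
          rw [mul_div_right_comm]
          gcongr C / m * ?_
          exact pow_le_pow_of_le_one hα₀ hα₁.le (Nat.le_succ j)
      _ = C / m * ∑ j ∈ range n, α ^ j := by rw [mul_sum]
      _ ≤ M := mul_le_mul_of_nonneg_left (hgeom n) (by positivity)
  have hinf : ∀ l x, influence c r (l + 1) x ≤ Real.exp M * (C * α ^ (l + 1) / m) := by
    intro l x
    have h1 := influence_le_log_sub_log ht hpos hr (fun l => by positivity)
      (fun l x => hm0.trans_le (hρm l x)) hd1 l x
    have h2 : (-1 : ℝ) ^ l * (Real.log (truncRatio c t 1 l x) - Real.log (r x)) ≤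
        C * α ^ (l + 1) / m := by
      rcases neg_one_pow_eq_or ℝ l with hl | hl <;> rw [hl]
      · linarith [hd2 l x]
      · linarith [hd1 l x]
    have h3 : Real.exp (-M) * influence c r (l + 1) x ≤ C * α ^ (l + 1) / m := by
      refine le_trans ?_ (h1.trans h2)
      have := influence_nonneg (c := c) hpos (l + 1) x
      gcongr
      exact hM l
    calc influence c r (l + 1) x
        = Real.exp M * (Real.exp (-M) * influence c r (l + 1) x) := by
          rw [← mul_assoc, ← Real.exp_add]; simp
      _ ≤ _ := by gcongr
  have hM0 : 0 ≤ M := by simpa using hM 0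
  refine ⟨1 + Real.exp M * M, fun n x => ?_⟩
  cases n with
  | zero => simp; positivity
  | succ n =>
    rw [sum_range_succ', add_comm]
    refine add_le_add le_rfl ?_
    calc ∑ l ∈ range n, influence c r (l + 1) x
        ≤ ∑ l ∈ range n, Real.exp M * (C * α ^ (l + 1) / m) := sum_le_sum fun l _ => hinf l x
      _ = Real.exp M * ∑ l ∈ range n, C * α ^ (l + 1) / m := by rw [mul_sum]
      _ ≤ _ := by gcongr; exact hM n

/-- This identity makes the influence sum the right weight for the complex induction: one step of
the recursion leaves a spare 1. -/
theorem sum_influence_succ (n : ℕ) (x : X) :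
    ∑ l ∈ range (n + 1), influence c r l x =
      1 + ∑ w, r (c x w) / (1 + r (c x w)) * ∑ l ∈ range n, influence c r l (c x w) := by
  rw [sum_range_succ', add_comm]
  simp only [influence, mul_sum]
  rw [sum_comm]

end Recursion

/-! ### Hard-core weights on rooted graphs and their factorization over joins -/

open Classical in
theorem prod_pinned_eq {V : Type*} [Fintype V] (D O : Finset V) (t : ℝ) (f : V → Bool) :
    (∏ x, if x ∈ D then (if f x = decide (x ∈ O) then (1 : ℝ) else 0) else if f x then t else 1) =
      if ∀ x ∈ D, f x = decide (x ∈ O) then t ^ #{x | x ∉ D ∧ f x = true} else 0 := by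
  split_ifs with h
  · rw [← prod_const, prod_filter]
    refine prod_congr rfl fun x _ => ?_
    by_cases hx : x ∈ D
    · simp [hx, h x hx]
    · simp [hx]
  · push Not at h
    obtain ⟨x, hx, hne⟩ := h
    exact prod_eq_zero (mem_univ x) (by simp [hx, hne])

namespace RootedGraph

/-- The occupied vertices of the configuration `f` form an independent set. -/
def IsIndep (T : RootedGraph.{u}) (f : T.Vert → Bool) : Prop :=
  ∀ x y, T.graph.Adj x y → ¬ (f x = true ∧ f y = true)

open Classical in
/-- The weighted sum over the independent configurations in which the root has state `b`. -/
def weightSum (T : RootedGraph.{u}) (w : T.Vert → Bool → ℝ) (b : Bool) : ℝ :=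
  ∑ f : T.Vert → Bool, if f T.root = b ∧ T.IsIndep f then ∏ x, w x (f x) else 0

/-- The weights of the hard-core model in which the vertices at distance `l` from the root are
pinned to the state `a`. -/
def pinWeight (T : RootedGraph.{u}) (t : ℝ) (l : ℕ) (a : Bool) (x : T.Vert) (b : Bool) : ℝ :=
  if T.graph.dist T.root x = l then (if b = a then 1 else 0) else if b then t else 1

-- Conditioning is rewritten as a product of vertex weights, because products split over the parts
-- of a join. The bijection sends I to the indicator of I ∪ σ⁻¹(1).
open Classical in
theorem sum_filter_eq_weightSum (T : RootedGraph.{u}) (σ : BoundaryCondition T.graph) (t : ℝ)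
    (hroot : T.root ∉ σ.dom) (b : Bool) :
    (∑ I : Finset T.Vert with ((T.root ∈ I ↔ b = true) ∧ Disjoint I σ.dom ∧
      T.graph.IsIndepSet ((I ∪ σ.occ : Finset T.Vert) : Set T.Vert)), t ^ I.card) =
    T.weightSum (fun x b => if x ∈ σ.dom then (if b = decide (x ∈ σ.occ) then 1 else 0)
      else if b then t else 1) b := by
  have hroot' : T.root ∉ σ.occ := fun h => hroot (σ.occ_subset h)
  simp only [weightSum, prod_pinned_eq, ← ite_and]
  rw [← sum_filter]
  have hindep : ∀ I : Finset T.Vert, T.graph.IsIndepSet (I : Set T.Vert) ↔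
      T.IsIndep fun x => decide (x ∈ I) := fun I => by
    refine ⟨fun h x y hxy hf => ?_, fun h x hx y hy _ hxy => ?_⟩
    · simp only [decide_eq_true_eq] at hf
      exact h hf.1 hf.2 hxy.ne hxy
    · exact h x y hxy ⟨by simpa using hx, by simpa using hy⟩
  refine sum_nbij' (fun I x => decide (x ∈ I ∪ σ.occ))
    (fun f => ({x | x ∉ σ.dom ∧ f x = true} : Finset T.Vert)) ?_ ?_ ?_ ?_ ?_
  · intro I hI
    simp only [mem_filter, mem_univ, true_and] at hI ⊢
    refine ⟨⟨?_, (hindep _).1 hI.2.2⟩, fun x hx => ?_⟩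
    · rw [Bool.eq_iff_iff, ← hI.1]
      simp [hroot']
    · have : x ∉ I := disjoint_right.1 hI.2.1 hx
      simp [this]
  · intro f hf
    simp only [mem_filter, mem_univ, true_and] at hf ⊢
    have hfun : (fun x => decide (x ∈ (({x | x ∉ σ.dom ∧ f x = true} : Finset T.Vert) ∪ σ.occ))) =
        f := by
      funext x
      rw [Bool.eq_iff_iff]
      by_cases hx : x ∈ σ.dom
      · simp [hx, hf.2 x hx]
      · have : x ∉ σ.occ := fun h => hx (σ.occ_subset h)
        simp [hx, this]
    refine ⟨by simp [hroot, hf.1.1], ?_, ?_⟩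
    · rw [disjoint_left]
      intro x hx
      simp only [mem_filter, mem_univ, true_and] at hx
      exact hx.1
    · rw [hindep, hfun]
      exact hf.1.2
  · intro I hI
    simp only [mem_filter, mem_univ, true_and] at hI
    ext x
    simp only [mem_filter, mem_univ, true_and, mem_union, decide_eq_true_eq]
    have h1 : x ∈ I → x ∉ σ.dom := fun h => disjoint_left.1 hI.2.1 h
    have h2 : x ∈ σ.occ → x ∈ σ.dom := fun h => σ.occ_subset h
    tauto
  · intro f hf
    simp only [mem_filter, mem_univ, true_and] at hf
    funext x
    rw [Bool.eq_iff_iff]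
    by_cases hx : x ∈ σ.dom
    · simp [hx, hf.2 x hx]
    · have : x ∉ σ.occ := fun h => hx (σ.occ_subset h)
      simp [hx, this]
  · intro I hI
    simp only [mem_filter, mem_univ, true_and] at hI
    congr 2
    ext x
    simp only [mem_filter, mem_univ, true_and, mem_union, decide_eq_true_eq]
    have h1 : x ∈ I → x ∉ σ.dom := fun h => disjoint_left.1 hI.2.1 h
    have h2 : x ∈ σ.occ → x ∈ σ.dom := fun h => σ.occ_subset h
    tauto

theorem condRatio_eq_weightSum_div (T : RootedGraph.{u}) (σ : BoundaryCondition T.graph) (t : ℝ)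
    (l : ℕ) (hl : 1 ≤ l) (a : Bool) (hreach : ∀ x, T.graph.Reachable T.root x)
    (hdom : σ.dom = T.sphere l) (hocc : ∀ x ∈ σ.dom, x ∈ σ.occ ↔ a = true) :
    condRatio T.graph σ T.root t =
      T.weightSum (T.pinWeight t l a) true / T.weightSum (T.pinWeight t l a) false := by
  classical
  -- Reachability is needed because `dist` takes the value 0 on unreachable pairs.
  have hmem : ∀ x, x ∈ σ.dom ↔ T.graph.dist T.root x = l := fun x => by
    simp [hdom, sphere, hreach x]
  have hroot : T.root ∉ σ.dom := by
    rw [hmem, SimpleGraph.dist_self]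
    omega
  have hw : (fun (x : T.Vert) (b : Bool) =>
      if x ∈ σ.dom then (if b = decide (x ∈ σ.occ) then (1 : ℝ) else 0)
        else if b then t else 1) = T.pinWeight t l a := by
    funext x b
    by_cases hx : x ∈ σ.dom
    · have h2 : decide (x ∈ σ.occ) = a := by
        rw [Bool.eq_iff_iff, ← hocc x hx]
        simp
      simp [pinWeight, hx, (hmem x).1 hx, h2]
    · simp [pinWeight, hx, mt (hmem x).2 hx]
  rw [condRatio, ← hw, ← sum_filter_eq_weightSum T σ t hroot,
    ← sum_filter_eq_weightSum T σ t hroot, condZIn, condZOut]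
  simp

section Join

variable {ι : Type u} [Fintype ι] (T : ι → RootedGraph.{u})

/-- The configuration on a join that is assembled from configurations on its parts. -/
def joinConfig (b : Bool) (g : ∀ i, (T i).Vert → Bool) : (join T).Vert → Bool
  | none => b
  | some ⟨i, x⟩ => g i x

/-- Configurations on a join correspond to tuples of configurations on its parts. -/
def joinConfigEquiv : (Bool × ∀ i, (T i).Vert → Bool) ≃ ((join T).Vert → Bool) where
  toFun p := joinConfig T p.1 p.2
  invFun f := (f none, fun i x => f (some ⟨i, x⟩))
  left_inv _ := rfl
  right_inv f := by
    funext x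
    match x with
    | none => rfl
    | some ⟨i, x⟩ => rfl

theorem isIndep_joinConfig (b : Bool) (g : ∀ i, (T i).Vert → Bool) :
    (join T).IsIndep (joinConfig T b g) ↔
      ∀ i, (b = true → g i (T i).root = false) ∧ (T i).IsIndep (g i) := by
  constructor
  · intro h i
    refine ⟨fun hb => ?_, fun x y hxy hf => ?_⟩
    · by_contra hne
      rw [Bool.not_eq_false] at hne
      exact h none (some ⟨i, (T i).root⟩) (JoinAdj.toRoot i) ⟨hb, hne⟩
    · exact h (some ⟨i, x⟩) (some ⟨i, y⟩) (JoinAdj.inner i x y hxy) hf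
  · intro h x y hxy hf
    have h' : JoinAdj T x y := hxy
    cases h' with
    | toRoot i =>
      have h1 := (h i).1 hf.1
      have h2 : g i (T i).root = true := hf.2
      simp [h1] at h2
    | fromRoot i =>
      have h1 := (h i).1 hf.2
      have h2 : g i (T i).root = true := hf.1
      simp [h1] at h2
    | inner i x y hadj => exact (h i).2 x y hadj hf

-- Once the state of the new root is fixed, the parts are independent; an occupied root only forces
-- their roots to be empty.
open Classical in
theorem weightSum_join (w : (join T).Vert → Bool → ℝ) (b : Bool) :
    (join T).weightSum w b = w none b * ∏ i, ∑ f : (T i).Vert → Bool,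
      if (b = true → f (T i).root = false) ∧ (T i).IsIndep f then
        ∏ x, w (some ⟨i, x⟩) (f x) else 0 := by
  rw [weightSum, ← (joinConfigEquiv T).sum_comp, Fintype.sum_prod_type, Fintype.prod_sum,
    mul_sum]
  rw [Finset.sum_eq_single b ?_ (by simp)]
  · refine sum_congr rfl fun g _ => ?_
    have hroot : joinConfigEquiv T (b, g) (join T).root = b := rfl
    have hind : (join T).IsIndep (joinConfigEquiv T (b, g)) ↔ _ := isIndep_joinConfig T b g
    have hprod : ∏ x, w x (joinConfigEquiv T (b, g) x) =
        w none b * ∏ i, ∏ x, w (some ⟨i, x⟩) (g i x) := by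
      rw [← Fintype.prod_sigma (fun p : Σ i, (T i).Vert => w (some p) (g p.1 p.2))]
      exact Fintype.prod_option (fun x => w x (joinConfigEquiv T (b, g) x))
    rw [hprod]
    simp only [hroot, hind, true_and, prod_ite_zero, mem_univ, forall_const]
    split_ifs <;> simp
  · intro b' _ hb'
    refine sum_eq_zero fun g _ => if_neg fun h => hb' h.1

theorem weightSum_join_true (w : (join T).Vert → Bool → ℝ) :
    (join T).weightSum w true =
      w none true * ∏ i, (T i).weightSum (fun x => w (some ⟨i, x⟩)) false := by
  classical
  rw [weightSum_join]
  simp [weightSum]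

theorem weightSum_join_false (w : (join T).Vert → Bool → ℝ) :
    (join T).weightSum w false =
      w none false * ∏ i, ((T i).weightSum (fun x => w (some ⟨i, x⟩)) true +
        (T i).weightSum (fun x => w (some ⟨i, x⟩)) false) := by
  classical
  rw [weightSum_join]
  congr 1
  refine prod_congr rfl fun i _ => ?_
  rw [weightSum, weightSum, ← sum_add_distrib]
  refine sum_congr rfl fun f _ => ?_
  cases f (T i).root <;> simp

end Join

/-! ### Distances in joins and the recursion for pinned spheres -/

/-- A rooted graph is layered if it is connected and no edge joins two vertices at the same
distance from the root. -/
def IsLayered (T : RootedGraph.{u}) : Prop :=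
  (∀ x, T.graph.Reachable T.root x) ∧
    ∀ x y, T.graph.Adj x y → T.graph.dist T.root x ≠ T.graph.dist T.root y

theorem dist_le_dist_add_one {V : Type*} {G : SimpleGraph V} {v x y : V} (h : G.Reachable v x)
    (hxy : G.Adj x y) : G.dist v y ≤ G.dist v x + 1 := by
  obtain ⟨p, hp⟩ := h.exists_walk_length_eq_dist
  simpa [hp] using SimpleGraph.dist_le (p.concat hxy)

/-- Growth by at most 1 along edges bounds the distance below by f; following predecessors down to v
yields a walk of length f x. -/
theorem reachable_and_dist_eq {V : Type*} (G : SimpleGraph V) (v : V) (f : V → ℕ) (hv : f v = 0)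
    (hadj : ∀ x y, G.Adj x y → f y ≤ f x + 1)
    (hpred : ∀ x, x ≠ v → ∃ y, G.Adj y x ∧ f y + 1 = f x) (x : V) :
    G.Reachable v x ∧ G.dist v x = f x := by
  have hlow : ∀ {x y : V} (p : G.Walk x y), f y ≤ f x + p.length := by
    intro x y p
    induction p with
    | nil => simp
    | cons h p ih =>
      have := hadj _ _ h
      rw [SimpleGraph.Walk.length_cons]
      omega
  have hup : ∀ n x, f x = n → ∃ p : G.Walk v x, p.length = n := by
    intro n
    induction n with
    | zero =>
      intro x hx
      by_cases hxv : x = v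
      · subst hxv
        exact ⟨.nil, rfl⟩
      · obtain ⟨y, -, hy⟩ := hpred x hxv
        omega
    | succ n ih =>
      intro x hx
      obtain ⟨y, hyx, hy⟩ := hpred x (by rintro rfl; omega)
      obtain ⟨p, hp⟩ := ih y (by omega)
      exact ⟨p.concat hyx, by simp [hp]⟩
  obtain ⟨p, hp⟩ := hup _ x rfl
  refine ⟨p.reachable, le_antisymm (hp ▸ SimpleGraph.dist_le p) ?_⟩
  obtain ⟨q, hq⟩ := p.reachable.exists_walk_length_eq_dist
  have := hlow q
  omega

section Join

variable {ι : Type u} [Fintype ι] (T : ι → RootedGraph.{u})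

/-- The depth of a vertex of a join. -/
def joinDepth : (join T).Vert → ℕ
  | none => 0
  | some ⟨i, x⟩ => (T i).graph.dist (T i).root x + 1

variable {T}

theorem reachable_and_dist_join (hT : ∀ i x, (T i).graph.Reachable (T i).root x)
    (x : (join T).Vert) :
    (join T).graph.Reachable (join T).root x ∧
      (join T).graph.dist (join T).root x = joinDepth T x := by
  refine reachable_and_dist_eq _ _ (joinDepth T) rfl ?_ ?_ x
  · intro x y hxy
    have h' : JoinAdj T x y := hxy
    cases h' with
    | toRoot i => simp [joinDepth]
    | fromRoot i => simp [joinDepth]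
    | inner i x y h => simpa [joinDepth] using dist_le_dist_add_one (hT i x) h
  · intro x hx
    match x with
    | none => exact absurd rfl hx
    | some ⟨i, x⟩ =>
      by_cases hxr : x = (T i).root
      · subst hxr
        exact ⟨none, JoinAdj.toRoot i, by simp [joinDepth]⟩
      · obtain ⟨p, hp⟩ := (hT i x).exists_walk_length_eq_dist
        have hnil : ¬ p.Nil := fun h => hxr h.eq.symm
        have hadj := p.adj_penultimate hnil
        have h1 := SimpleGraph.dist_le p.dropLast
        have h2 := p.length_dropLast_add_one hnil
        have h3 := dist_le_dist_add_one (hT i p.penultimate) hadj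
        refine ⟨some ⟨i, p.penultimate⟩, JoinAdj.inner i _ _ hadj, ?_⟩
        simp only [joinDepth]
        omega

theorem IsLayered.join (hT : ∀ i, (T i).IsLayered) : (join T).IsLayered := by
  have h := reachable_and_dist_join fun i => (hT i).1
  refine ⟨fun x => (h x).1, fun x y hxy => ?_⟩
  rw [(h x).2, (h y).2]
  have h' : JoinAdj T x y := hxy
  cases h' with
  | toRoot i => simp [joinDepth]
  | fromRoot i => simp [joinDepth]
  | inner i x y h => simpa [joinDepth] using (hT i).2 x y h

theorem pinWeight_join_some (hT : ∀ i x, (T i).graph.Reachable (T i).root x) (t : ℝ) (l : ℕ)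
    (a : Bool) (i : ι) (x : (T i).Vert) :
    (RootedGraph.join T).pinWeight t (l + 1) a (some ⟨i, x⟩) = (T i).pinWeight t l a x := by
  funext b
  have h : (RootedGraph.join T).graph.dist (RootedGraph.join T).root (some ⟨i, x⟩) =
    (T i).graph.dist (T i).root x + 1 := (reachable_and_dist_join hT (some ⟨i, x⟩)).2
  simp [pinWeight, h]

theorem pinWeight_succ_root (T : RootedGraph.{u}) (t : ℝ) (l : ℕ) (a b : Bool) :
    T.pinWeight t (l + 1) a T.root b = if b then t else 1 := by
  simp [pinWeight]

theorem weightSum_pinWeight_zero (T : RootedGraph.{u}) (t : ℝ) {a b : Bool} (h : b ≠ a) :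
    T.weightSum (T.pinWeight t 0 a) b = 0 := by
  classical
  refine sum_eq_zero fun f _ => ?_
  split_ifs with hf
  · refine prod_eq_zero (mem_univ T.root) ?_
    simp [pinWeight, hf.1, h]
  · rfl

theorem pinWeight_nonneg (T : RootedGraph.{u}) {t : ℝ} (ht : 0 < t) (l : ℕ) (a : Bool)
    (x : T.Vert) (b : Bool) : 0 ≤ T.pinWeight t l a x b := by
  rw [pinWeight]
  split_ifs <;> positivity

theorem weightSum_pinWeight_zero_pos {T : RootedGraph.{u}} (hT : T.IsLayered) {t : ℝ} (ht : 0 < t)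
    (a : Bool) : 0 < T.weightSum (T.pinWeight t 0 a) a := by
  classical
  have hterm : ∀ f : T.Vert → Bool, 0 ≤ if f T.root = a ∧ T.IsIndep f then
      ∏ x, T.pinWeight t 0 a x (f x) else 0 := fun f => by
    split_ifs
    · exact prod_nonneg fun x _ => T.pinWeight_nonneg ht _ _ _ _
    · rfl
  refine lt_of_lt_of_le ?_ (single_le_sum (fun f _ => hterm f)
    (mem_univ (Function.update (fun _ => false) T.root a)))
  rw [if_pos]
  · refine prod_pos fun x _ => ?_
    by_cases hx : x = T.root
    · subst hx
      simp [pinWeight]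
    · have hd : T.graph.dist T.root x ≠ 0 := by
        rw [Ne, (hT.1 x).dist_eq_zero_iff]
        exact Ne.symm hx
      simp [pinWeight, hd, Function.update_of_ne hx]
  · refine ⟨by simp, fun x y hxy hf => ?_⟩
    have h : ∀ z, Function.update (fun _ => false) T.root a z = true → z = T.root := by
      intro z hz
      by_contra hne
      simp [Function.update_of_ne hne] at hz
    exact hxy.ne ((h x hf.1).trans (h y hf.2).symm)

/-- The probability that the root is unoccupied when the vertices at distance `l` are pinned. -/
def outProb (T : RootedGraph.{u}) (t : ℝ) (l : ℕ) (a : Bool) : ℝ :=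
  T.weightSum (T.pinWeight t l a) false /
    (T.weightSum (T.pinWeight t l a) true + T.weightSum (T.pinWeight t l a) false)

/-- Vertices below the pinned root stay free, but their total weight cancels in the quotient. -/
theorem outProb_zero {T : RootedGraph.{u}} (hT : T.IsLayered) {t : ℝ} (ht : 0 < t) (a : Bool) :
    T.outProb t 0 a = if a then 0 else 1 := by
  have h := weightSum_pinWeight_zero_pos hT ht a
  cases a
  · simp [outProb, weightSum_pinWeight_zero T t (a := false) (b := true) (by simp), h.ne']
  · simp [outProb, weightSum_pinWeight_zero T t (a := true) (b := false) (by simp)]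

theorem weightSum_pinWeight_join_true (hT : ∀ i, (T i).IsLayered) (t : ℝ) (l : ℕ) (a : Bool) :
    (RootedGraph.join T).weightSum ((RootedGraph.join T).pinWeight t (l + 1) a) true =
      t * ∏ i, (T i).weightSum ((T i).pinWeight t l a) false := by
  rw [weightSum_join_true]
  have h := pinWeight_succ_root (RootedGraph.join T) t l a true
  rw [if_pos rfl] at h
  refine congrArg₂ (· * ·) h (prod_congr rfl fun i _ => ?_)
  simp only [pinWeight_join_some fun i => (hT i).1]

theorem weightSum_pinWeight_join_false (hT : ∀ i, (T i).IsLayered) (t : ℝ) (l : ℕ) (a : Bool) :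
    (RootedGraph.join T).weightSum ((RootedGraph.join T).pinWeight t (l + 1) a) false =
      ∏ i, ((T i).weightSum ((T i).pinWeight t l a) true +
        (T i).weightSum ((T i).pinWeight t l a) false) := by
  rw [weightSum_join_false]
  have h := pinWeight_succ_root (RootedGraph.join T) t l a false
  rw [if_neg Bool.false_ne_true] at h
  refine (congrArg₂ (· * ·) h (prod_congr rfl fun i _ => ?_)).trans (one_mul _)
  simp only [pinWeight_join_some fun i => (hT i).1]

theorem weightSum_div_join (hT : ∀ i, (T i).IsLayered) (t : ℝ) (l : ℕ) (a : Bool) :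
    (RootedGraph.join T).weightSum ((RootedGraph.join T).pinWeight t (l + 1) a) true /
      (RootedGraph.join T).weightSum ((RootedGraph.join T).pinWeight t (l + 1) a) false =
        t * ∏ i, (T i).outProb t l a := by
  rw [weightSum_pinWeight_join_true hT, weightSum_pinWeight_join_false hT, mul_div_assoc,
    ← prod_div_distrib]
  rfl

theorem outProb_join_succ (hT : ∀ i, (T i).IsLayered) (t : ℝ) (l : ℕ) (a : Bool)
    (hpos : ∀ i, 0 < (T i).weightSum ((T i).pinWeight t l a) true +
      (T i).weightSum ((T i).pinWeight t l a) false) :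
    (RootedGraph.join T).outProb t (l + 1) a = (1 + t * ∏ i, (T i).outProb t l a)⁻¹ := by
  rw [← weightSum_div_join hT, outProb]
  have h : 0 < (RootedGraph.join T).weightSum
      ((RootedGraph.join T).pinWeight t (l + 1) a) false := by
    rw [weightSum_pinWeight_join_false hT]
    exact prod_pos fun i _ => hpos i
  have h' := h.ne'
  rw [one_add_div h', inv_div, add_comm (RootedGraph.weightSum _ _ true)]

theorem weightSum_pinWeight_nonneg (T : RootedGraph.{u}) {t : ℝ} (ht : 0 < t) (l : ℕ)
    (a b : Bool) : 0 ≤ T.weightSum (T.pinWeight t l a) b := by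
  classical
  refine sum_nonneg fun f _ => ?_
  split_ifs
  · exact prod_nonneg fun x _ => T.pinWeight_nonneg ht _ _ _ _
  · rfl

theorem weightSum_pinWeight_join_pos (hT : ∀ i, (T i).IsLayered) {t : ℝ} (ht : 0 < t) (l : ℕ)
    (a : Bool)
    (hpos : ∀ i, 0 < (T i).weightSum ((T i).pinWeight t l a) true +
      (T i).weightSum ((T i).pinWeight t l a) false) :
    0 < (RootedGraph.join T).weightSum ((RootedGraph.join T).pinWeight t (l + 1) a) true +
      (RootedGraph.join T).weightSum ((RootedGraph.join T).pinWeight t (l + 1) a) false := by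
  refine add_pos_of_nonneg_of_pos (weightSum_pinWeight_nonneg _ ht _ _ _) ?_
  rw [weightSum_pinWeight_join_false hT]
  exact prod_pos fun i _ => hpos i

theorem weightSum_pinWeight_zero_add_pos {T : RootedGraph.{u}} (hT : T.IsLayered) {t : ℝ}
    (ht : 0 < t) (a : Bool) :
    0 < T.weightSum (T.pinWeight t 0 a) true + T.weightSum (T.pinWeight t 0 a) false := by
  have h := weightSum_pinWeight_zero_pos hT ht a
  have h' := fun b => weightSum_pinWeight_nonneg T ht 0 a b
  cases a
  · linarith [h' true]
  · linarith [h' false]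

end Join
end RootedGraph

/-! ### From mixing on trees of self-avoiding walks to the abstract recursion -/

section SawTree

open Classical in
theorem sawTree_isLayered {V : Type u} [LinearOrder V] (G : SimpleGraph V) (S : Finset V) (v : S) :
    (sawTree G S v).IsLayered := by
  rw [sawTree]
  exact RootedGraph.IsLayered.join fun w => sawTree_isLayered G _ _
termination_by S.card
decreasing_by exact card_sawRemaining_lt G S v w.1 v.2

-- The sum over both root states is used since either state alone has weight 0 when a root is pinned
-- to the other.
open Classical in
theorem weightSum_sawTree_pos {V : Type u} [LinearOrder V] (G : SimpleGraph V) {t : ℝ}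
    (ht : 0 < t) (a : Bool) (l : ℕ) (S : Finset V) (v : S) :
    0 < (sawTree G S v).weightSum ((sawTree G S v).pinWeight t l a) true +
      (sawTree G S v).weightSum ((sawTree G S v).pinWeight t l a) false := by
  induction l generalizing S v with
  | zero => exact RootedGraph.weightSum_pinWeight_zero_add_pos (sawTree_isLayered G S v) ht a
  | succ l ih =>
    rw [sawTree]
    exact RootedGraph.weightSum_pinWeight_join_pos (fun w => sawTree_isLayered G _ _) ht l a
      fun w => ih _ _

open Classical in
/-- The ratio at the root of the tree of self avoiding walks. -/
def sawRatio {V : Type u} [LinearOrder V] (G : SimpleGraph V) (t : ℝ) (S : Finset V) (v : S) : ℝ :=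
  t * ∏ w : {w : S // G.Adj v w}, (1 + sawRatio G t (sawRemaining G S v w.1)
    ⟨w.1, mem_sawRemaining G S v w.1 w.1.2 w.2⟩)⁻¹
termination_by S.card
decreasing_by exact card_sawRemaining_lt G S v w.1 v.2

open Classical in
theorem sawRatio_pos {V : Type u} [LinearOrder V] (G : SimpleGraph V) {t : ℝ} (ht : 0 < t)
    (S : Finset V) (v : S) : 0 < sawRatio G t S v := by
  rw [sawRatio]
  refine mul_pos ht (prod_pos fun w _ => inv_pos.2 ?_)
  exact add_pos one_pos (sawRatio_pos G ht _ _)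
termination_by S.card
decreasing_by exact card_sawRemaining_lt G S v w.1 v.2

variable {ι : Type*} {V : ι → Type u} [∀ i, LinearOrder (V i)] (G : ∀ i, SimpleGraph (V i))

/-- The neighbours, in the induced subgraph `S`, of the vertex `v`, for `x = (i, S, v)`. -/
abbrev Branch (x : Σ i, Σ S : Finset (V i), S) : Type u := {w : x.2.1 // (G x.1).Adj x.2.2 w}

open Classical in
instance (x : Σ i, Σ S : Finset (V i), S) : Fintype (Branch G x) :=
  inferInstanceAs (Fintype {w : x.2.1 // (G x.1).Adj x.2.2 w})

/-- The rooted induced subgraph that belongs to a child of the root of the tree of self avoiding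
walks. -/
def child (x : Σ i, Σ S : Finset (V i), S) (w : Branch G x) : Σ i, Σ S : Finset (V i), S :=
  ⟨x.1, sawRemaining (G x.1) x.2.1 x.2.2 w.1,
    ⟨w.1, mem_sawRemaining (G x.1) x.2.1 x.2.2 w.1 w.1.2 w.2⟩⟩

theorem sawRatio_eq (t : ℝ) (x : Σ i, Σ S : Finset (V i), S) :
    sawRatio (G x.1) t x.2.1 x.2.2 = t * ∏ w : Branch G x,
      (1 + sawRatio (G (child G x w).1) t (child G x w).2.1 (child G x w).2.2)⁻¹ := by
  rw [sawRatio]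
  rfl

/-- Pinning to occupied (a = true) means that the probability of being unoccupied is 0, hence the
reversed initial values. -/
theorem outProb_sawTree {t : ℝ} (ht : 0 < t) (a : Bool) (l : ℕ)
    (x : Σ i, Σ S : Finset (V i), S) :
    (sawTree (G x.1) x.2.1 x.2.2).outProb t l a =
      truncOut (child G) t (if a then 0 else 1) l x := by
  induction l generalizing x with
  | zero => exact RootedGraph.outProb_zero (sawTree_isLayered _ _ _) ht a
  | succ l ih =>
    rw [sawTree, RootedGraph.outProb_join_succ (fun w => sawTree_isLayered _ _ _) t l a
      fun w => weightSum_sawTree_pos _ ht _ _ _ _, truncOut]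
    simp only [← ih]
    rfl

theorem weightSum_div_sawTree {t : ℝ} (ht : 0 < t) (a : Bool) (l : ℕ)
    (x : Σ i, Σ S : Finset (V i), S) :
    (sawTree (G x.1) x.2.1 x.2.2).weightSum
        ((sawTree (G x.1) x.2.1 x.2.2).pinWeight t (l + 1) a) true /
      (sawTree (G x.1) x.2.1 x.2.2).weightSum
        ((sawTree (G x.1) x.2.1 x.2.2).pinWeight t (l + 1) a) false =
      truncRatio (child G) t (if a then 0 else 1) l x := by
  rw [sawTree, RootedGraph.weightSum_div_join (fun w => sawTree_isLayered _ _ _), truncRatio]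
  simp only [← outProb_sawTree G ht]
  rfl

theorem RootedGraph.IsLayered.isIndepSet_sphere {T : RootedGraph.{u}} (hT : T.IsLayered) (l : ℕ) :
    T.graph.IsIndepSet (T.sphere l : Set T.Vert) := by
  intro x hx y hy _ hxy
  simp only [RootedGraph.sphere, coe_filter, mem_univ, true_and, Set.mem_ofPred_eq] at hx hy
  exact hT.2 x y hxy (hx.2.trans hy.2.symm)

/-- Only the all-empty and all-occupied boundaries are compared; the latter is admissible because
spheres of a layered graph are independent. -/
theorem VSSM.abs_truncRatio_sub_le {t : ℝ} (ht : 0 < t) (h : VSSM V G t) :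
    ∃ α C : ℝ, 0 ≤ α ∧ α < 1 ∧ 0 < C ∧ ∀ (l : ℕ) (x : Σ i, Σ S : Finset (V i), S),
      |truncRatio (child G) t 1 l x - truncRatio (child G) t 0 l x| ≤ C * α ^ (l + 1) := by
  obtain ⟨α, C, hα₀, hα₁, hC, h⟩ := h
  refine ⟨α, C, hα₀, hα₁, hC, fun l x => ?_⟩
  have hT := sawTree_isLayered (G x.1) x.2.1 x.2.2
  have h1 := weightSum_div_sawTree G ht false l x
  have h0 := weightSum_div_sawTree G ht true l x
  simp only [Bool.false_eq_true, if_false, if_true] at h1 h0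
  set T := sawTree (G x.1) x.2.1 x.2.2
  let σ : BoundaryCondition T.graph :=
    ⟨T.sphere (l + 1), ∅, empty_subset _, by simp⟩
  let τ : BoundaryCondition T.graph :=
    ⟨T.sphere (l + 1), T.sphere (l + 1), Subset.rfl, hT.isIndepSet_sphere _⟩
  have := h x.1 x.2.1 x.2.2 (l + 1) (by omega) σ τ rfl rfl
  rwa [T.condRatio_eq_weightSum_div σ t (l + 1) (by omega) false hT.1 rfl (by simp [σ]),
    T.condRatio_eq_weightSum_div τ t (l + 1) (by omega) true hT.1 rfl (by simp [τ]),
    h1, h0] at this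

end SawTree

theorem card_branch_le {ι : Type*} {V : ι → Type u} (G : ∀ i, SimpleGraph (V i))
    [∀ i, Fintype (V i)]
    [∀ i, DecidableRel (G i).Adj] {Δ : ℕ}
    (hΔ : ∀ i, (G i).maxDegree ≤ Δ) (x : Σ i, Σ S : Finset (V i), S) :
    Fintype.card (Branch G x) ≤ Δ := by
  refine le_trans ?_ (((G x.1).degree_le_maxDegree x.2.2).trans (hΔ x.1))
  rw [← SimpleGraph.card_neighborFinset_eq_degree, ← Finset.card_univ]
  refine card_le_card_of_injOn (fun w => (w.1 : V x.1)) (fun w _ => ?_) fun w _ w' _ h => ?_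
  · simpa using w.2
  · exact Subtype.ext (Subtype.ext h)

/-! ### Complex ratios on induced subgraphs -/

section InducedPolynomial

variable {V : Type u} [LinearOrder V] (G : SimpleGraph V) (x : V → ℂ)

open Classical in
/-- The independence polynomial of the subgraph induced by `S`. -/
def indepPolyOn (S : Finset V) : ℂ :=
  ∑ I ∈ S.powerset.filter (fun I : Finset V => G.IsIndepSet (I : Set V)), ∏ v ∈ I, x v

theorem indepPolyOn_univ [Fintype V] : indepPolyOn G x univ = indepPoly G x := by
  rw [indepPolyOn, powerset_univ, indepPoly]
  congr!

open Classical in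
/-- The vertices of `S` that are neither equal nor adjacent to `v`. -/
def nonNeighbors (S : Finset V) (v : V) : Finset V := {y ∈ S | y ≠ v ∧ ¬ G.Adj v y}

theorem indepPolyOn_eq_add {S : Finset V} {v : V} (hv : v ∈ S) :
    indepPolyOn G x S =
      indepPolyOn G x (S.erase v) + x v * indepPolyOn G x (nonNeighbors G S v) := by
  classical
  simp only [indepPolyOn]
  rw [← sum_filter_not_add_sum_filter _ (fun I => v ∈ I), filter_filter, filter_filter, mul_sum]
  congr 1
  · refine sum_congr ?_ fun _ _ => rfl
    ext I
    simp only [mem_filter, mem_powerset, subset_erase]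
    tauto
  · refine sum_nbij' (fun I => I.erase v) (fun I => insert v I) ?_ ?_ ?_ ?_ ?_
    · intro I hI
      simp only [mem_filter, mem_powerset] at hI ⊢
      refine ⟨fun y hy => ?_, hI.2.1.mono (by simp)⟩
      rw [mem_erase] at hy
      simp only [nonNeighbors, mem_filter]
      exact ⟨hI.1 hy.2, hy.1, hI.2.1 (mem_coe.2 hI.2.2) (mem_coe.2 hy.2) hy.1.symm⟩
    · intro I hI
      simp only [mem_filter, mem_powerset] at hI ⊢
      have hI' : ∀ y ∈ I, y ∈ S ∧ y ≠ v ∧ ¬ G.Adj v y := fun y hy => by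
        simpa [nonNeighbors] using hI.1 hy
      refine ⟨insert_subset hv fun y hy => (hI' y hy).1, ?_, mem_insert_self _ _⟩
      rw [coe_insert]
      exact hI.2.insert fun y hy _ => ⟨(hI' y hy).2.2, fun h => (hI' y hy).2.2 h.symm⟩
    · intro I hI
      simp only [mem_filter] at hI
      exact insert_erase hI.2.2
    · intro I hI
      simp only [mem_filter, mem_powerset] at hI
      refine erase_insert fun h => ?_
      simpa [nonNeighbors] using hI.1 h
    · intro I hI
      simp only [mem_filter] at hI
      exact (mul_prod_erase I x hI.2.2).symm

/-- Telescoping: the elements of W are deleted in increasing order, each deletion costing a factor g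
w. -/
theorem eq_prod_mul_of_step {R : Type*} [CommMonoid R] (f : Finset V → R) (g : V → R)
    (U W : Finset V)
    (h : ∀ w ∈ W, f {y ∈ U | ¬ (y ∈ W ∧ y < w)} = g w * f {y ∈ U | ¬ (y ∈ W ∧ y ≤ w)}) :
    f U = (∏ w ∈ W, g w) * f {y ∈ U | y ∉ W} := by
  induction W using Finset.induction_on_max with
  | empty => simp
  | insert a W ha ih =>
    have haW : a ∉ W := fun h => (ha a h).false
    rw [ih, prod_insert haW, mul_comm (g a), mul_assoc]
    · congr 1
      have h' := h a (mem_insert_self a W)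
      have e1 : ({y ∈ U | ¬ (y ∈ insert a W ∧ y < a)} : Finset V) = {y ∈ U | y ∉ W} := by
        refine filter_congr fun y _ => ?_
        rw [mem_insert]
        have := ha y
        grind
      have e2 : ({y ∈ U | ¬ (y ∈ insert a W ∧ y ≤ a)} : Finset V) =
          {y ∈ U | y ∉ insert a W} := by
        refine filter_congr fun y _ => ?_
        rw [mem_insert]
        have := ha y
        grind
      rwa [e1, e2] at h'
    · intro w hw
      have h' := h w (mem_insert_of_mem hw)
      have haw := ha w hw
      have e1 : ({y ∈ U | ¬ (y ∈ insert a W ∧ y < w)} : Finset V) =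
          {y ∈ U | ¬ (y ∈ W ∧ y < w)} := by
        refine filter_congr fun y _ => ?_
        rw [mem_insert]
        grind
      have e2 : ({y ∈ U | ¬ (y ∈ insert a W ∧ y ≤ w)} : Finset V) =
          {y ∈ U | ¬ (y ∈ W ∧ y ≤ w)} := by
        refine filter_congr fun y _ => ?_
        rw [mem_insert]
        grind
      rwa [e1, e2] at h'

/-- The complex ratio of the vertex `v` in the subgraph induced by `S`. -/
def complexRatio (S : Finset V) (v : V) : ℂ :=
  x v * indepPolyOn G x (nonNeighbors G S v) / indepPolyOn G x (S.erase v)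

theorem indepPolyOn_eq_mul {S : Finset V} {v : V} (hv : v ∈ S)
    (h : indepPolyOn G x (S.erase v) ≠ 0) :
    indepPolyOn G x S = (1 + complexRatio G x S v) * indepPolyOn G x (S.erase v) := by
  rw [complexRatio, one_add_mul, div_mul_cancel₀ _ h]
  exact indepPolyOn_eq_add G x hv

-- Deleting the neighbours of v in increasing order passes exactly through the sets `sawRemaining`,
-- so the complex ratios obey the recursion of the tree of self-avoiding walks.
open Classical in
theorem indepPolyOn_erase_eq_prod {S : Finset V} (v : S)
    (h : ∀ w : {w : S // G.Adj v w},
      indepPolyOn G x ((sawRemaining G S v w.1).erase w.1) ≠ 0) :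
    indepPolyOn G x (S.erase v) =
      (∏ w : {w : S // G.Adj v w}, (1 + complexRatio G x (sawRemaining G S v w.1) w.1)) *
        indepPolyOn G x (nonNeighbors G S v) := by
  have key := eq_prod_mul_of_step (indepPolyOn G x)
    (fun w => 1 + complexRatio G x (sawRemaining G S v w) w) (S.erase v)
    {y ∈ S | G.Adj v y} ?_
  · rw [key]
    congr 1
    · symm
      refine prod_nbij (fun w => (w.1 : V)) ?_ ?_ ?_ ?_
      · intro w _
        simpa using w.2
      · intro w _ w' _ h
        exact Subtype.ext (Subtype.ext h)
      · intro w hw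
        simp only [coe_filter, Set.mem_ofPred_eq] at hw
        exact ⟨⟨⟨w, hw.1⟩, hw.2⟩, by simp, rfl⟩
      · intro w _
        rfl
    · congr 1
      ext y
      simp only [nonNeighbors, mem_filter, mem_erase]
      tauto
  · intro w hw
    rw [mem_filter] at hw
    have e1 : ({y ∈ S.erase v | ¬ (y ∈ ({y ∈ S | G.Adj v y} : Finset V) ∧ y < w)} : Finset V) =
        sawRemaining G S v w := by
      ext y
      simp only [sawRemaining, mem_filter, mem_erase]
      tauto
    have e2 : ({y ∈ S.erase v | ¬ (y ∈ ({y ∈ S | G.Adj v y} : Finset V) ∧ y ≤ w)} : Finset V) =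
        (sawRemaining G S v w).erase w := by
      ext y
      simp only [sawRemaining, mem_filter, mem_erase]
      have hadj := hw.2
      have := hadj.ne
      grind
    rw [e1, e2]
    exact indepPolyOn_eq_mul G x (mem_sawRemaining G S v w hw.1 hw.2) (h ⟨⟨w, hw.1⟩, hw.2⟩)

theorem complexRatio_eq {S : Finset V} (v : S) (h0 : indepPolyOn G x (S.erase v) ≠ 0)
    {P : ℂ} (hP : indepPolyOn G x (S.erase v) = P * indepPolyOn G x (nonNeighbors G S v)) :
    complexRatio G x S v = x v * P⁻¹ := by
  rw [hP] at h0
  rw [complexRatio, hP]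
  have h1 := left_ne_zero_of_mul h0
  have h2 := right_ne_zero_of_mul h0
  field_simp

end InducedPolynomial

/-! ### Stability of the recursion under complex perturbation -/

/-- Take u = log (1 + y) with y = p (e^z - 1), p = r / (1 + r). The linear coefficient must be
exactly p. Of the constant 5, the exponential contributes 1 and the logarithm 4, through ‖y‖ ≤ 2‖z‖.
-/
theorem exists_one_add_mul_exp_eq {r : ℝ} (hr : 0 < r) {z : ℂ} (hz : ‖z‖ ≤ 1 / 4) :
    ∃ u : ℂ, 1 + r * Complex.exp z = (1 + r) * Complex.exp u ∧
      ‖u‖ ≤ r / (1 + r) * ‖z‖ + 5 * ‖z‖ ^ 2 := by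
  set p := r / (1 + r) with hp
  have hp0 : 0 ≤ p := by positivity
  have hp1 : p ≤ 1 := by rw [hp, div_le_one (by positivity)]; linarith
  set y : ℂ := p * (Complex.exp z - 1) with hy
  have hn := norm_nonneg z
  have hexp : ‖Complex.exp z - 1‖ ≤ ‖z‖ + ‖z‖ ^ 2 := by
    have h := Complex.norm_exp_sub_one_sub_id_le (x := z) (by linarith)
    calc ‖Complex.exp z - 1‖ = ‖z + (Complex.exp z - 1 - z)‖ := by ring_nf
      _ ≤ ‖z‖ + ‖Complex.exp z - 1 - z‖ := norm_add_le _ _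
      _ ≤ _ := by gcongr
  have hyn : ‖y‖ ≤ p * (‖z‖ + ‖z‖ ^ 2) := by
    rw [hy, norm_mul, Complex.norm_real, Real.norm_of_nonneg hp0]
    gcongr
  have hy2 : ‖y‖ ≤ 2 * ‖z‖ := by nlinarith
  have hy3 : ‖y‖ ≤ 1 / 2 := by linarith
  have hne : 1 + y ≠ 0 := by
    intro h
    have h' : y = -1 := by linear_combination h
    rw [h'] at hy3
    norm_num at hy3
  refine ⟨Complex.log (1 + y), ?_, ?_⟩
  · rw [Complex.exp_log hne, hy, hp]
    have : (1 + r : ℂ) ≠ 0 := by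
      have h : (1 + r : ℝ) ≠ 0 := by positivity
      exact_mod_cast h
    push_cast
    field_simp
    ring
  · have h := Complex.norm_log_one_add_le (z := y) (by linarith)
    have hinv : (1 - ‖y‖)⁻¹ ≤ 2 := by
      rw [inv_le_comm₀ (by linarith) (by norm_num)]
      linarith
    have hsq : ‖y‖ ^ 2 ≤ (2 * ‖z‖) ^ 2 := by gcongr
    calc ‖Complex.log (1 + y)‖ ≤ ‖y‖ ^ 2 * (1 - ‖y‖)⁻¹ / 2 + ‖y‖ := h
      _ ≤ ‖y‖ ^ 2 * 2 / 2 + ‖y‖ := by gcongr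
      _ ≤ _ := by nlinarith

section ZeroFree

variable {ι : Type*} {V : ι → Type u} [∀ i, LinearOrder (V i)] {G : ∀ i, SimpleGraph (V i)}

/-- If the total influence on the root is bounded, then the complex ratios remain close to the real
ones, on a logarithmic scale, and the independence polynomial does not vanish. -/
theorem indepPolyOn_ne_zero_and_complexRatio {t K δ : ℝ} {Δ : ℕ} (ht : 0 < t)
    (hΔ : ∀ x, Fintype.card (Branch G x) ≤ Δ)
    (hK : ∀ n x, ∑ l ∈ range n,
      influence (child G) (fun x => sawRatio (G x.1) t x.2.1 x.2.2) l x ≤ K)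
    (hδ : 0 < δ) (hδK : δ * K ≤ 1 / 4) (hδΔ : 5 * Δ * (δ * K) ^ 2 ≤ δ / 2)
    {i : ι} {x : V i → ℂ} (hx : ∀ v, ∃ ζ : ℂ, ‖ζ‖ ≤ δ / 2 ∧ x v = t * Complex.exp ζ)
    (n : ℕ) (S : Finset (V i)) (hS : S.card ≤ n) :
    indepPolyOn (G i) x S ≠ 0 ∧ ∀ v : S, ∃ z : ℂ,
      ‖z‖ ≤ δ * ∑ l ∈ range n,
        influence (child G) (fun x => sawRatio (G x.1) t x.2.1 x.2.2) l ⟨i, S, v⟩ ∧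
      complexRatio (G i) x S v = sawRatio (G i) t S v * Complex.exp z := by
  classical
  -- Both claims are proved together, as the ratio recursion divides by polynomials of smaller
  -- subgraphs. The bound S.card ≤ n lets n also serve as the truncation depth of the influence sum,
  -- which drops by one at each child.
  induction n generalizing S with
  | zero =>
    have hS0 : S = ∅ := by simpa using hS
    subst hS0
    refine ⟨?_, fun v => absurd v.2 (notMem_empty _)⟩
    simp [indepPolyOn, filter_singleton]
  | succ n ih =>
    set r : (Σ i, Σ S : Finset (V i), S) → ℝ := fun x => sawRatio (G x.1) t x.2.1 x.2.2 with hr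
    have hrpos : ∀ y, 0 < r y := fun y => sawRatio_pos _ ht _ _
    have hratio : ∀ v : S, ∃ z : ℂ,
        ‖z‖ ≤ δ * ∑ l ∈ range (n + 1), influence (child G) r l ⟨i, S, v⟩ ∧
        complexRatio (G i) x S v = sawRatio (G i) t S v * Complex.exp z := by
      intro v
      have herase : indepPolyOn (G i) x (S.erase v) ≠ 0 := by
        refine (ih _ ?_).1
        rw [card_erase_of_mem v.2]
        omega
      have hcard : ∀ w : Branch G ⟨i, S, v⟩, (sawRemaining (G i) S v w.1).card ≤ n := fun w => by
        have := card_sawRemaining_lt (G i) S v w.1 v.2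
        omega
      have hprod := indepPolyOn_erase_eq_prod (G i) x v fun w => (ih _ (by
        refine (card_erase_le).trans (hcard w))).1
      have hchild : ∀ w : Branch G ⟨i, S, v⟩, ∃ u : ℂ,
          1 + complexRatio (G i) x (sawRemaining (G i) S v w.1) w.1 =
            (1 + r (child G ⟨i, S, v⟩ w)) * Complex.exp u ∧
          ‖u‖ ≤ δ * (r (child G ⟨i, S, v⟩ w) / (1 + r (child G ⟨i, S, v⟩ w)) *
            ∑ l ∈ range n, influence (child G) r l (child G ⟨i, S, v⟩ w)) +
              5 * (δ * K) ^ 2 := by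
        intro w
        obtain ⟨z, hz, hzeq⟩ := (ih _ (hcard w)).2
          ⟨w.1, mem_sawRemaining (G i) S v w.1 w.1.2 w.2⟩
        have hzK : ‖z‖ ≤ δ * K := hz.trans (by gcongr; exact hK _ _)
        obtain ⟨u, hu, hun⟩ := exists_one_add_mul_exp_eq (hrpos (child G ⟨i, S, v⟩ w))
          (hzK.trans hδK)
        refine ⟨u, ?_, hun.trans ?_⟩
        · rw [← hu, hzeq]
          rfl
        · have hpw := hrpos (child G ⟨i, S, v⟩ w)
          refine add_le_add ?_ (by gcongr)
          rw [mul_left_comm]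
          exact mul_le_mul_of_nonneg_left hz (by positivity)
      choose u hu hun using hchild
      obtain ⟨ζ, hζ, hxv⟩ := hx v
      refine ⟨ζ - ∑ w, u w, ?_, ?_⟩
      · calc ‖ζ - ∑ w, u w‖ ≤ ‖ζ‖ + ∑ w, ‖u w‖ :=
              (norm_sub_le _ _).trans (by gcongr; exact norm_sum_le _ _)
          _ ≤ δ / 2 + ∑ w, (δ * (r (child G ⟨i, S, v⟩ w) / (1 + r (child G ⟨i, S, v⟩ w)) *
                ∑ l ∈ range n, influence (child G) r l (child G ⟨i, S, v⟩ w)) +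
                  5 * (δ * K) ^ 2) := by
              gcongr with w
              exact hun w
          _ ≤ δ / 2 + (δ * ∑ w, r (child G ⟨i, S, v⟩ w) / (1 + r (child G ⟨i, S, v⟩ w)) *
                ∑ l ∈ range n, influence (child G) r l (child G ⟨i, S, v⟩ w) +
                  Δ * (5 * (δ * K) ^ 2)) := by
              rw [sum_add_distrib, mul_sum, sum_const, nsmul_eq_mul, Finset.card_univ]
              gcongr
              exact hΔ _
          -- The two halves of δ, from the vertex weight and from at most Δ quadratic errors, make
          -- up the summand 1 in `sum_influence_succ`.
          _ ≤ _ := by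
              rw [sum_influence_succ]
              linarith
      · rw [complexRatio_eq (G i) x v herase hprod, hxv]
        have hreq := sawRatio_eq G t ⟨i, S, v⟩
        simp only at hreq
        rw [hreq, Complex.exp_sub, Complex.exp_sum]
        have hP : (∏ w : {w : S // (G i).Adj v w},
            (1 + complexRatio (G i) x (sawRemaining (G i) S v w.1) w.1)) =
            ∏ w : Branch G ⟨i, S, v⟩,
              (1 + (r (child G ⟨i, S, v⟩ w) : ℂ)) * Complex.exp (u w) :=
          prod_congr rfl fun w _ => hu w
        rw [hP, prod_mul_distrib]
        push_cast
        rw [prod_inv_distrib]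
        simp only [hr]
        rw [mul_inv]
        ring
    refine ⟨?_, hratio⟩
    rcases S.eq_empty_or_nonempty with hS0 | ⟨v, hv⟩
    · exact (ih S (by simp [hS0])).1
    · have herase : indepPolyOn (G i) x (S.erase v) ≠ 0 := by
        refine (ih _ ?_).1
        rw [card_erase_of_mem hv]
        omega
      obtain ⟨z, hz, hzeq⟩ := hratio ⟨v, hv⟩
      have hzK : ‖z‖ ≤ δ * K := hz.trans (by gcongr; exact hK _ _)
      obtain ⟨u, hu, -⟩ := exists_one_add_mul_exp_eq (hrpos ⟨i, S, ⟨v, hv⟩⟩) (hzK.trans hδK)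
      rw [indepPolyOn_eq_mul (G i) x hv herase]
      refine mul_ne_zero ?_ herase
      rw [hzeq, hu]
      refine mul_ne_zero ?_ (Complex.exp_ne_zero _)
      have h : (1 + r ⟨i, S, ⟨v, hv⟩⟩ : ℝ) ≠ 0 := by
        have := hrpos ⟨i, S, ⟨v, hv⟩⟩
        positivity
      exact_mod_cast h

end ZeroFree

/-! ### Choice of constants and conclusion -/

theorem exists_eq_mul_exp {t δ : ℝ} (ht : 0 < t) (hδ : δ ≤ 1) {x : ℂ}
    (hx : x ∈ Metric.ball (t : ℂ) (t * δ / 3)) :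
    ∃ ζ : ℂ, ‖ζ‖ ≤ δ / 2 ∧ x = t * Complex.exp ζ := by
  have htc : (t : ℂ) ≠ 0 := by exact_mod_cast ht.ne'
  set y : ℂ := (x - t) / t with hy
  have hxy : x = t * (1 + y) := by
    rw [hy]
    field_simp
    ring
  have hyn : ‖y‖ ≤ δ / 3 := by
    rw [mem_ball_iff_norm] at hx
    rw [hy, norm_div, Complex.norm_real, Real.norm_of_nonneg ht.le, div_le_iff₀ ht]
    linarith
  have hne : 1 + y ≠ 0 := by
    intro h
    have h' : y = -1 := by linear_combination h
    rw [h', norm_neg, norm_one] at hyn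
    linarith
  refine ⟨Complex.log (1 + y), ?_, by rw [Complex.exp_log hne, hxy]⟩
  -- The logarithm loses a factor 3/2, which turns δ / 3 into δ / 2.
  have := Complex.norm_log_one_add_half_le_self (z := y) (by linarith)
  linarith

end

end HardCore

theorem theorem1p3 {ι : Type*} (V : ι → Type*) [∀ i, Fintype (V i)] [∀ i, LinearOrder (V i)]
    (G : ∀ i, SimpleGraph (V i)) [∀ i, DecidableRel (G i).Adj]
    (Δ : ℕ) (hΔ : ∀ i, (G i).maxDegree ≤ Δ)
    (t : ℝ) (ht : 0 < t) (hmix : HardCore.VSSM V G t) :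
    ∃ ε : ℝ, 0 < ε ∧ ∀ (i : ι) (x : V i → ℂ),
      (∀ v, x v ∈ Metric.ball (t : ℂ) ε) → HardCore.indepPoly (G i) x ≠ 0 := by
  open HardCore in
  obtain ⟨α, C, hα₀, hα₁, hC, h⟩ := hmix.abs_truncRatio_sub_le G ht
  obtain ⟨K₀, hK₀⟩ := exists_sum_influence_le ht (card_branch_le G hΔ)
    (fun x => sawRatio_pos (G x.1) ht x.2.1 x.2.2) (sawRatio_eq G t) hα₀ hα₁ hC h
  -- With K ≥ 1, the bound on δ K² also controls δ K and δ.
  set K := max K₀ 1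
  have hK1 : 1 ≤ K := le_max_right _ _
  have hK0 : 0 < K := by linarith
  set δ : ℝ := 1 / (10 * (Δ + 1) * K ^ 2) with hδ
  have hδ0 : 0 < δ := by positivity
  have hδeq : 10 * (Δ + 1) * (δ * K ^ 2) = 1 := by
    rw [hδ]
    field_simp
  have hΔ0 : (0 : ℝ) ≤ Δ := Nat.cast_nonneg Δ
  have hδK2 : δ * K ^ 2 ≤ 1 / 10 := by nlinarith [mul_nonneg hΔ0 (by positivity : 0 ≤ δ * K ^ 2)]
  have hδK : δ * K ≤ 1 / 10 := le_trans (by gcongr; exact le_self_pow₀ hK1 two_ne_zero) hδK2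
  have hδ1 : δ ≤ 1 / 10 := le_trans (le_mul_of_one_le_right hδ0.le hK1) hδK
  refine ⟨t * δ / 3, by positivity, fun i x hx => ?_⟩
  rw [← indepPolyOn_univ]
  refine (indepPolyOn_ne_zero_and_complexRatio (K := K) ht (card_branch_le G hΔ)
    (fun n y => (hK₀ n y).trans (le_max_left _ _)) hδ0 (by linarith) ?_
    (fun v => exists_eq_mul_exp ht (by linarith) (hx v)) _ Finset.univ le_rfl).1
  calc 5 * Δ * (δ * K) ^ 2 = δ * (5 * Δ * (δ * K ^ 2)) := by ring
    _ ≤ δ * (1 / 2) := by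
      gcongr
      nlinarith [mul_nonneg hδ0.le (sq_nonneg K)]
    _ = δ / 2 := by ring
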